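/- Let $C$ be a smooth projective irreducible curve over an algebraically closed field $k$ (in particular, $C$ may be a general curve of genus $g$). For $e\ge 0$ let $C_e=C^e/S_e$ be the $e$-th symmetric product, i.e. the variety of effective divisors of degree $e$ on $C$. Let $r,d$ be non-negative integers and let $l=(L,V)$ be a complete linear series of type $g^r_d$ on $C$, that is, $L$ is a line bundle of degree $d$, $V=H^0(C,L)$ and $\dim V=r+1$. For $D\in C_e$ let $l-D$ be the linear series $\bigl(L(-D),\,V\cap H^0(C,L(-D))\bigr)$, with $\dim(l-D)=\dim_k\bigl(V\cap H^0(C,L(-D))\bigr)-1$ (so $\dim(l-D)=-1$ if $l-D$ is empty), and for an integer $c$ let $$V_e^{c}(l)=\{D\in C_e \mid \dim(l-D)\ge r-c\}\subset C_e$$ be the set, with the Zariski topology, of effective divisors of degree $e$ that impose at most $c$ conditions on $l$. Let $e,f$ be integers with $0\le f<e<d$ and $e-f\le r+1$. Then no irreducible component of $V_e^{e-f}(l)$ is entirely contained in $V_e^{e-f-1}(l)$. -/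

import Mathlib

open CategoryTheory CategoryTheory.Limits AlgebraicGeometry

universe u

namespace SecantVarieties

/-! ### Two facts on smooth curves

The local ring of a smooth curve at a closed point is a discrete valuation ring.  This is what
makes the spaces `L(A)` below linear subspaces of the function field. -/

theorem isDiscreteValuationRing_of_kaehler {R O : Type*} [CommRing R] [CommRing O] [IsDomain O]
    [IsNoetherianRing O] [IsLocalRing O] [Algebra R O]
    (hb : Function.Bijective (algebraMap R (IsLocalRing.ResidueField O)))
    [Algebra.FormallySmooth R O] (e : KaehlerDifferential R O ≃ₗ[O] O) :
    IsDiscreteValuationRing O := by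
  let K := IsLocalRing.ResidueField O
  have hs : Function.Surjective (algebraMap O K) := IsLocalRing.residue_surjective
  have hker : RingHom.ker (algebraMap O K) = IsLocalRing.maximalIdeal O :=
    IsLocalRing.ker_residue
  have : Algebra.FormallySmooth R K :=
    Algebra.FormallySmooth.of_equiv (AlgEquiv.ofBijective (Algebra.ofId R K) hb)
  obtain ⟨l, hl⟩ := (Algebra.FormallySmooth.iff_split_injection (R := R) hs).mp this
  have hinj : Function.Injective (KaehlerDifferential.kerCotangentToTensor R O K) :=
    fun x y h => by
      have := congrArg l h
      simpa [← LinearMap.comp_apply, hl] using this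
  have hsub : Subsingleton (KaehlerDifferential R K) :=
    KaehlerDifferential.subsingleton_of_surjective R K hb.2
  have hsur : Function.Surjective (KaehlerDifferential.kerCotangentToTensor R O K) := fun y =>
    (KaehlerDifferential.exact_kerCotangentToTensor_mapBaseChange R O K hs y).mp
      (Subsingleton.elim _ _)
  let e' : (RingHom.ker (algebraMap O K)).Cotangent ≃ₗ[O] K :=
    (LinearEquiv.ofBijective _ ⟨hinj, hsur⟩).trans
      ((LinearEquiv.lTensor K e).trans (TensorProduct.rid O K))
  have hK : IsSimpleModule O K := by
    have := (inferInstance : IsSimpleModule K K)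
    rwa [isSimpleModule_iff_isSimpleModule_of_algebraMap_surjective (S := K) hs]
  have hsimp : IsSimpleModule O (RingHom.ker (algebraMap O K)).Cotangent :=
    IsSimpleModule.congr e'
  rw [hker] at hsimp
  rw [← IsLocalRing.finrank_CotangentSpace_eq_one_iff]
  have hsimp' : IsSimpleModule O (IsLocalRing.CotangentSpace O) := hsimp
  have := (isSimpleModule_iff_isSimpleModule_of_algebraMap_surjective
    (S := K) (M := IsLocalRing.CotangentSpace O) hs).mp hsimp'
  exact isSimpleModule_iff_finrank_eq_one.mp this

theorem isIso_toResidueField {k : Type u} [Field k] [IsAlgClosed k] {X : Scheme.{u}}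
    (f : X ⟶ Spec (.of k)) [LocallyOfFiniteType f] {x : X} (hx : IsClosed {x}) :
    IsIso (f.appTop ≫ X.presheaf.germ ⊤ x trivial ≫ X.residue x) := by
  have h1 : (X.fromSpecResidueField x ≫ f).appTop =
      (f.appTop ≫ X.presheaf.germ ⊤ x trivial ≫ X.residue x) ≫
        (Scheme.ΓSpecIso (X.residueField x)).inv := by
    rw [Scheme.fromSpecResidueField, Category.assoc, Scheme.Hom.comp_appTop,
      Scheme.Hom.comp_appTop, Scheme.fromSpecStalk_appTop]
    simp [← Scheme.ΓSpecIso_inv_naturality]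
  have h2 : IsIso (X.fromSpecResidueField x ≫ f).appTop := by
    rw [← SpecMap_residueFieldIsoBase_inv f x hx]
    have : IsIso (Spec.map (residueFieldIsoBase f x hx).inv) := inferInstance
    exact inferInstanceAs (IsIso ((Spec.map (residueFieldIsoBase f x hx).inv).app ⊤))
  rw [h1] at h2
  exact IsIso.of_isIso_comp_right _ (Scheme.ΓSpecIso (X.residueField x)).inv

theorem isDiscreteValuationRing_stalk {k : Type u} [Field k] [IsAlgClosed k] {X : Scheme.{u}}
    (f : X ⟶ Spec (.of k)) [IsIntegral X] [SmoothOfRelativeDimension 1 f] {x : X}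
    (hx : IsClosed {x}) : IsDiscreteValuationRing (X.presheaf.stalk x) := by
  have : Smooth f := SmoothOfRelativeDimension.smooth 1 f
  have : IsLocallyNoetherian X := LocallyOfFiniteType.isLocallyNoetherian f
  obtain ⟨U, hU, V, hV, hxV, e, h⟩ :=
    SmoothOfRelativeDimension.exists_isStandardSmoothOfRelativeDimension (n := 1) (f := f) x
  obtain rfl : U = ⊤ := by
    have : Subsingleton (Spec (.of k)) := inferInstanceAs (Subsingleton (PrimeSpectrum k))
    ext y
    simpa using Subsingleton.elim (f x) y ▸ e hxV
  have hr := isIso_toResidueField f hx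
  algebraize [(f.appLE ⊤ V e).hom, (X.presheaf.germ V x hxV).hom,
    (X.presheaf.germ V x hxV).hom.comp (f.appLE ⊤ V e).hom]
  have hloc : IsLocalization.AtPrime (X.presheaf.stalk x) (hV.primeIdealOf ⟨x, hxV⟩).asIdeal :=
    hV.isLocalization_stalk ⟨x, hxV⟩
  have : Algebra.FormallyEtale Γ(X, V) (X.presheaf.stalk x) :=
    Algebra.FormallyEtale.of_isLocalization (hV.primeIdealOf ⟨x, hxV⟩).asIdeal.primeCompl
  have : Algebra.IsStandardSmooth Γ(Spec (.of k), ⊤) Γ(X, V) :=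
    Algebra.IsStandardSmoothOfRelativeDimension.isStandardSmooth 1
  have : Algebra.FormallySmooth Γ(Spec (.of k), ⊤) (X.presheaf.stalk x) :=
    Algebra.FormallySmooth.comp _ Γ(X, V) _
  have : Nonempty V := ⟨⟨x, hxV⟩⟩
  have hrank : Module.rank Γ(X, V) (KaehlerDifferential Γ(Spec (.of k), ⊤) Γ(X, V)) = (1 : ℕ) :=
    Algebra.IsStandardSmoothOfRelativeDimension.rank_kaehlerDifferential 1
  have e₀ : KaehlerDifferential Γ(Spec (.of k), ⊤) Γ(X, V) ≃ₗ[Γ(X, V)] Γ(X, V) :=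
    LinearEquiv.ofRankEq _ _ (by simpa using hrank)
  refine isDiscreteValuationRing_of_kaehler (R := Γ(Spec (.of k), ⊤)) ?_
    ((KaehlerDifferential.tensorKaehlerEquivOfFormallyEtale _ Γ(X, V) _).symm.trans
      ((TensorProduct.AlgebraTensorModule.congr (.refl _ _) e₀).trans
        (TensorProduct.AlgebraTensorModule.rid _ _ _)))
  have : (algebraMap Γ(Spec (.of k), ⊤) (IsLocalRing.ResidueField (X.presheaf.stalk x))) =
      (f.appTop ≫ X.presheaf.germ ⊤ x trivial ≫ X.residue x).hom := by
    have : f.appTop ≫ X.presheaf.germ ⊤ x trivial ≫ X.residue x =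
      f.appLE ⊤ V e ≫ X.presheaf.germ V x hxV ≫ X.residue x := by
      rw [Scheme.Hom.appLE, Category.assoc, X.presheaf.germ_res_assoc]
      rfl
    rw [this]
    rfl
  rw [this]
  exact ConcreteCategory.bijective_of_isIso _

/-! ### Rational points with the Zariski topology -/

/-- The `k`-rational points of a `k`-scheme `X`: the sections of `X → Spec k`.  For `k`
algebraically closed and `X` locally of finite type these are the closed points of `X`. -/
def RatPoint {k : Type u} [Field k] (X : Over (Spec (.of k))) : Type u :=
  Over.mk (𝟙 (Spec (.of k))) ⟶ X

/-- The image of a `k`-rational point under a morphism of `k`-schemes. -/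
noncomputable def RatPoint.map {k : Type u} [Field k] {X Y : Over (Spec (.of k))} (p : RatPoint X)
    (g : X ⟶ Y) : RatPoint Y :=
  CategoryStruct.comp (X := Over.mk (𝟙 (Spec (.of k)))) p g

/-- The point of the underlying space of `X` given by a `k`-rational point. -/
noncomputable def RatPoint.pt {k : Type u} [Field k] {X : Over (Spec (.of k))}
    (p : RatPoint X) : X.left :=
  p.left (IsLocalRing.closedPoint k)

/-- The Zariski topology on the `k`-rational points of `X`, i.e. the subspace topology. -/
noncomputable instance RatPoint.instTopologicalSpace {k : Type u} [Field k] {X : Over (Spec (.of k))} :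
    TopologicalSpace (RatPoint X) :=
  TopologicalSpace.induced RatPoint.pt inferInstance

theorem RatPoint.isClosed_pt {k : Type u} [Field k] [IsAlgClosed k] {X : Over (Spec (.of k))}
    [LocallyOfFiniteType X.hom] (p : RatPoint X) : IsClosed {p.pt} :=
  (pointEquivClosedPoint X.hom ⟨p.left, Over.w p⟩).2

end SecantVarieties

open SecantVarieties

/-- A smooth projective (irreducible) curve over the field `k`: an integral scheme, proper and
smooth of relative dimension one over `k`.  (A proper curve is projective.) -/
structure SmoothProjectiveCurve (k : Type u) [Field k] where
  /-- the underlying scheme -/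
  scheme : Scheme.{u}
  /-- the structure morphism -/
  str : scheme ⟶ Spec (.of k)
  isIntegral : IsIntegral scheme
  isProper : IsProper str
  smooth : SmoothOfRelativeDimension 1 str

namespace SmoothProjectiveCurve

variable {k : Type u} [Field k]

instance (C : SmoothProjectiveCurve k) : IsIntegral C.scheme := C.isIntegral

instance (C : SmoothProjectiveCurve k) : IsProper C.str := C.isProper

instance (C : SmoothProjectiveCurve k) : SmoothOfRelativeDimension 1 C.str := C.smooth

instance (C : SmoothProjectiveCurve k) : IsLocallyNoetherian C.scheme :=
  LocallyOfFiniteType.isLocallyNoetherian C.str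

/-- The curve as an object of the category of `k`-schemes. -/
noncomputable abbrev toOver (C : SmoothProjectiveCurve k) : Over (Spec (.of k)) := Over.mk C.str

instance (C : SmoothProjectiveCurve k) : LocallyOfFiniteType C.toOver.hom :=
  inferInstanceAs (LocallyOfFiniteType C.str)

/-- The (closed) points of the curve. -/
noncomputable abbrev Point (C : SmoothProjectiveCurve k) : Type u := RatPoint C.toOver

/-- The field `k` as constant functions in the function field `k(C)`. -/
noncomputable def constants (C : SmoothProjectiveCurve k) : k →+* C.scheme.functionField :=
  ((Scheme.ΓSpecIso (.of k)).inv ≫ C.str.appTop ≫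
    C.scheme.presheaf.germ ⊤ (genericPoint C.scheme) trivial).hom

noncomputable instance (C : SmoothProjectiveCurve k) : Algebra k C.scheme.functionField :=
  C.constants.toAlgebra

/-- The order of vanishing of a rational function at a point of the curve. -/
noncomputable def ordAt (C : SmoothProjectiveCurve k) (P : C.Point)
    (φ : C.scheme.functionField) : ℤ :=
  Scheme.ord (X := C.scheme) φ P.pt

theorem ordAt_add [IsAlgClosed k] (C : SmoothProjectiveCurve k) (P : C.Point)
    {φ ψ : C.scheme.functionField} (h : φ + ψ ≠ 0) :
    min (C.ordAt P φ) (C.ordAt P ψ) ≤ C.ordAt P (φ + ψ) := by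
  have : IsDiscreteValuationRing (C.scheme.presheaf.stalk P.pt) :=
    isDiscreteValuationRing_stalk C.str (RatPoint.isClosed_pt P)
  exact Scheme.ord_add h

theorem ordAt_constants (C : SmoothProjectiveCurve k) (P : C.Point) {c : k} (hc : c ≠ 0) :
    C.ordAt P (C.constants c) = 0 := by
  have : Nonempty (⊤ : C.scheme.Opens) := ⟨⟨genericPoint C.scheme, trivial⟩⟩
  have hu : IsUnit (((Scheme.ΓSpecIso (.of k)).inv ≫ C.str.appTop).hom c) :=
    (IsUnit.mk0 c hc).map ((Scheme.ΓSpecIso (.of k)).inv ≫ C.str.appTop).hom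
  exact Scheme.ord_of_isUnit (U := ⊤) hu trivial

theorem ordAt_smul (C : SmoothProjectiveCurve k) (P : C.Point) {c : k} (hc : c ≠ 0)
    (φ : C.scheme.functionField) : C.ordAt P (c • φ) = C.ordAt P φ := by
  rcases eq_or_ne φ 0 with h | hφ
  · rw [h, smul_zero]
  · have hc' : C.constants c ≠ 0 := (map_ne_zero C.constants).mpr hc
    have h1 : C.ordAt P (C.constants c * φ) = C.ordAt P (C.constants c) + C.ordAt P φ :=
      Scheme.ord_mul hc' hφ
    rw [C.ordAt_constants P hc, zero_add] at h1
    exact h1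

/-! ### Divisors and linear series -/

/-- Divisors on the curve. -/
abbrev Divisor (C : SmoothProjectiveCurve k) : Type u := C.Point →₀ ℤ

/-- The space `L(A) = H⁰(C, 𝒪_C(A))` of rational functions `φ` with `φ = 0` or
`div φ + A ≥ 0`. -/
noncomputable def globalSections [IsAlgClosed k] (C : SmoothProjectiveCurve k) (A : C.Divisor) :
    Submodule k C.scheme.functionField where
  carrier := {φ | φ = 0 ∨ ∀ P, 0 ≤ C.ordAt P φ + A P}
  zero_mem' := Or.inl rfl
  add_mem' := by
    rintro φ ψ hφ hψ
    rcases eq_or_ne φ 0 with rfl | hφ0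
    · simpa using hψ
    rcases eq_or_ne ψ 0 with rfl | hψ0
    · simpa using hφ
    rcases eq_or_ne (φ + ψ) 0 with h | h
    · exact Or.inl h
    · refine Or.inr fun P => ?_
      have h1 := hφ.resolve_left hφ0 P
      have h2 := hψ.resolve_left hψ0 P
      have h3 := C.ordAt_add P h
      rcases min_le_iff.mp h3 with h4 | h4 <;> linarith
  smul_mem' := by
    rintro c φ hφ
    rcases eq_or_ne c 0 with rfl | hc
    · exact Or.inl (zero_smul _ _)
    rcases hφ with rfl | hφ
    · exact Or.inl (smul_zero _)
    · exact Or.inr fun P => by rw [C.ordAt_smul P hc]; exact hφ P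

/-- A linear series `l = (L, V)` of type `g^r_d` on the curve: a line bundle `L` of degree `d`,
given as `L = 𝒪_C(A)` for a divisor `A` of degree `d` (every line bundle on a smooth curve is of
this form), and an `(r+1)`-dimensional subspace `V` of `H⁰(C, L) = L(A)`. -/
structure LinearSeries [IsAlgClosed k] (C : SmoothProjectiveCurve k) (r d : ℕ) where
  /-- the divisor `A` with `L = 𝒪_C(A)` -/
  divisor : C.Divisor
  degree_eq : divisor.degree = d
  /-- the space of sections `V` -/
  space : Submodule k C.scheme.functionField
  space_le : space ≤ C.globalSections divisor
  finrank_eq : Module.finrank k space = r + 1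

/-- The linear series `l = (L, V)` is complete if `V = H⁰(C, L)`. -/
def LinearSeries.IsComplete [IsAlgClosed k] {C : SmoothProjectiveCurve k} {r d : ℕ}
    (l : C.LinearSeries r d) : Prop :=
  l.space = C.globalSections l.divisor

/-! ### Symmetric products and secant varieties -/

/-- The `e`-th symmetric product `C_e`, as the set of effective divisors of degree `e`. -/
def SymProd (C : SmoothProjectiveCurve k) (e : ℕ) : Type u := Sym C.Point e

/-- The `e`-fold product `C^e = C ×ₖ ⋯ ×ₖ C` as a `k`-scheme. -/
noncomputable abbrev power (C : SmoothProjectiveCurve k) (e : ℕ) : Over (Spec (.of k)) :=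
  ∏ᶜ fun _ : Fin e => C.toOver

/-- The quotient map `C^e → C_e`, `(P₁, …, P_e) ↦ P₁ + ⋯ + P_e`, on points. -/
noncomputable def toSymProd (C : SmoothProjectiveCurve k) (e : ℕ) (p : RatPoint (C.power e)) :
    C.SymProd e :=
  ⟨(Finset.univ : Finset (Fin e)).val.map fun i => p.map (Pi.π (fun _ => C.toOver) i),
    (Multiset.card_map _ _).trans (by simp)⟩

/-- The Zariski topology of the variety `C_e = C^e / S_e` on its points: the quotient topology
of the Zariski topology of the `e`-fold product. -/
noncomputable instance (C : SmoothProjectiveCurve k) (e : ℕ) : TopologicalSpace (C.SymProd e) :=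
  TopologicalSpace.coinduced (C.toSymProd e) inferInstance

/-- A point of `C_e` regarded as an (effective) divisor on `C`. -/
noncomputable def SymProd.toDivisor {C : SmoothProjectiveCurve k} {e : ℕ} (D : C.SymProd e) :
    C.Divisor :=
  (D.1.map fun P => Finsupp.single P (1 : ℤ)).sum

/-- The dimension of the linear series `l - D = (L(-D), V ∩ H⁰(C, L(-D)))`, equal to `-1` if
`l - D` is empty. -/
noncomputable def LinearSeries.dimSub [IsAlgClosed k] {C : SmoothProjectiveCurve k} {r d e : ℕ}
    (l : C.LinearSeries r d) (D : C.SymProd e) : ℤ :=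
  (Module.finrank k ↥(l.space ⊓ C.globalSections (l.divisor - D.toDivisor)) : ℤ) - 1

/-- The secant variety `V_e^c(l) ⊆ C_e` of the effective divisors `D` of degree `e` that impose
at most `c` conditions on `l`, i.e. with `dim (l - D) ≥ r - c`. -/
def LinearSeries.secantVariety [IsAlgClosed k] {C : SmoothProjectiveCurve k} {r d : ℕ}
    (l : C.LinearSeries r d) (e : ℕ) (c : ℤ) : Set (C.SymProd e) :=
  {D | (r : ℤ) - c ≤ l.dimSub D}

end SmoothProjectiveCurve

/-! ### Rational points and finite products of `k`-schemes -/

namespace SecantVarieties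

/-! Put `c = e - f` and suppose a component of `V_e^c(l)` lies in `V_e^{c-1}(l)`. As `C_e` is
Noetherian, some open `O ⊆ C_e` meets `V_e^c(l)` in a nonempty subset of that component, so inside
`O` membership in `V_e^c(l)` forces membership in `V_e^{c-1}(l)`.

Exchanging one point of a divisor raises the number of conditions by at most one
(`symPoint_update_mem_secantVariety`). A divisor of `O ∩ V_e^c(l)` therefore stays in `V_e^c(l)`
when one of its points moves, and for a general new point it also stays in `O`, hence falls back
into `V_e^{c-1}(l)`. The exchange can be repeated until all `e` points have been replaced
(`exists_rankSub_le`).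

A general point imposes a new condition on a nonempty series
(`exists_isOpen_rankSub_add_single_le`), so the final divisor imposes `min(e, r+1)` conditions. This
exceeds `e - f - 1`, because `f ≥ 0` and `e - f ≤ r + 1`: a contradiction. -/

theorem RatPoint.map_map {k : Type u} [Field k] {X Y Z : Over (Spec (.of k))}
    (p : RatPoint X) (g : X ⟶ Y) (h : Y ⟶ Z) : (p.map g).map h = p.map (g ≫ h) :=
  Category.assoc (W := Over.mk (𝟙 (Spec (.of k)))) p g h

theorem RatPoint.map_id {k : Type u} [Field k] {X : Over (Spec (.of k))}
    (p : RatPoint X) : p.map (𝟙 X) = p :=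
  Category.comp_id (X := Over.mk (𝟙 (Spec (.of k)))) p

theorem RatPoint.pt_map {k : Type u} [Field k] {X Y : Over (Spec (.of k))}
    (p : RatPoint X) (g : X ⟶ Y) : (p.map g).pt = g.left p.pt := by
  rfl

theorem RatPoint.continuous_pt {k : Type u} [Field k] {X : Over (Spec (.of k))} :
    Continuous (RatPoint.pt (X := X)) :=
  continuous_induced_dom

theorem RatPoint.continuous_map {k : Type u} [Field k] {X Y : Over (Spec (.of k))}
    (g : X ⟶ Y) : Continuous fun p : RatPoint X => p.map g := by
  refine continuous_induced_rng.mpr ?_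
  have : RatPoint.pt ∘ (fun p : RatPoint X => p.map g) = g.left ∘ RatPoint.pt :=
    funext fun p => RatPoint.pt_map p g
  rw [this]
  exact g.left.continuous.comp RatPoint.continuous_pt

theorem RatPoint.exists_pt_eq {k : Type u} [Field k] [IsAlgClosed k] {X : Over (Spec (.of k))}
    [LocallyOfFiniteType X.hom] {x : X.left} (hx : IsClosed {x}) :
    ∃ p : RatPoint X, p.pt = x :=
  ⟨Over.homMk (pointOfClosedPoint X.hom x hx) (by simp),
    pointOfClosedPoint_apply X.hom x hx _⟩

theorem RatPoint.exists_pt_mem {k : Type u} [Field k] [IsAlgClosed k] {X : Over (Spec (.of k))}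
    [LocallyOfFiniteType X.hom] {U : Set X.left} (hU : IsOpen U) (hne : U.Nonempty) :
    ∃ p : RatPoint X, p.pt ∈ U := by
  have : JacobsonSpace (Spec (.of k)) := inferInstance
  have : JacobsonSpace X.left := LocallyOfFiniteType.jacobsonSpace X.hom
  obtain ⟨x, hxU, hx⟩ := nonempty_inter_closedPoints hne hU.isLocallyClosed
  obtain ⟨p, rfl⟩ := RatPoint.exists_pt_eq hx
  exact ⟨p, hxU⟩

/-- In a Jacobson scheme every nonempty open set contains a closed point, here a rational one.
Applied to the intersection of two opens, this carries irreducibility over to rational points. -/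
theorem RatPoint.preirreducibleSpace {k : Type u} [Field k] [IsAlgClosed k]
    {X : Over (Spec (.of k))} [LocallyOfFiniteType X.hom] [PreirreducibleSpace X.left] :
    PreirreducibleSpace (RatPoint X) := by
  refine ⟨fun U V hU₁ hV₁ hU' hV' => ?_⟩
  obtain ⟨U, hU, rfl⟩ := isOpen_induced_iff.mp hU₁
  obtain ⟨V, hV, rfl⟩ := isOpen_induced_iff.mp hV₁
  obtain ⟨p, -, hp⟩ := hU'
  obtain ⟨q, -, hq⟩ := hV'
  obtain ⟨s, hs⟩ := RatPoint.exists_pt_mem (hU.inter hV)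
    (nonempty_preirreducible_inter hU hV ⟨_, hp⟩ ⟨_, hq⟩)
  exact ⟨s, trivial, hs⟩

/-- Induction on the number of factors: a product over `S` is a fibre product, so its structure map
is a base change of that of `X 0` followed by that of the remaining product. It serves to make `C^e`
Noetherian. -/
theorem exists_fan_over_fin {D : Type*} [Category D] {S : D}
    [HasPullbacks D] (P : MorphismProperty D) [P.IsMultiplicative] [P.IsStableUnderBaseChange] :
    ∀ {n : ℕ} (X : Fin n → Over S), (∀ i, P (X i).hom) →
      ∃ c : Fan X, Nonempty (IsLimit c) ∧ P c.pt.hom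
  | 0, X, _ => by
    refine ⟨Fan.mk (Over.mk (𝟙 S)) fun i => i.elim0, ⟨?_⟩, P.id_mem S⟩
    exact Fan.IsLimit.mk _ (fun s => Over.mkIdTerminal.from s.pt) (fun _ i => i.elim0)
      fun _ _ _ => Over.mkIdTerminal.hom_ext _ _
  | n + 1, X, hX => by
    obtain ⟨c, ⟨hc⟩, hPc⟩ := exists_fan_over_fin P (fun i => X i.succ) fun i => hX _
    have : HasBinaryProducts (Over S) := Over.ConstructProducts.over_binaryProduct_of_pullback
    refine ⟨extendFan c (BinaryFan.mk (prod.fst : X 0 ⨯ c.pt ⟶ X 0) prod.snd),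
      ⟨extendFanIsLimit X hc (prodIsProd _ _)⟩, ?_⟩
    have h := Over.isPullback_of_binaryFan_isLimit _ (prodIsProd (X 0) c.pt)
    have h' : P (prod.snd : X 0 ⨯ c.pt ⟶ c.pt).left := P.of_isPullback h (hX 0)
    have := P.comp_mem _ _ h' hPc
    rwa [Over.w] at this

theorem pi_over_fin {D : Type*} [Category D] {S : D}
    [HasPullbacks D] (P : MorphismProperty D) [P.IsMultiplicative] [P.IsStableUnderBaseChange]
    {n : ℕ} (X : Fin n → Over S) [HasProduct X] (hX : ∀ i, P (X i).hom) : P (∏ᶜ X).hom := by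
  obtain ⟨c, ⟨hc⟩, hPc⟩ := exists_fan_over_fin P X hX
  let e : ∏ᶜ X ≅ c.pt := (productIsProduct X).conePointUniqueUpToIso hc
  rw [← Over.w e.hom]
  exact P.comp_mem _ _ (P.of_isIso ((Over.forget S).mapIso e).hom) hPc

end SecantVarieties

/-! ### Topology of `C^e` and `C_e` -/

namespace SmoothProjectiveCurve

variable {k : Type u} [Field k]

instance (C : SmoothProjectiveCurve k) (e : ℕ) : LocallyOfFiniteType (C.power e).hom :=
  pi_over_fin @LocallyOfFiniteType _ fun _ =>
    inferInstanceAs (LocallyOfFiniteType C.str)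

instance (C : SmoothProjectiveCurve k) (e : ℕ) : QuasiCompact (C.power e).hom :=
  pi_over_fin @QuasiCompact _ fun _ =>
    inferInstanceAs (QuasiCompact C.str)

instance (C : SmoothProjectiveCurve k) (e : ℕ) :
    TopologicalSpace.NoetherianSpace (RatPoint (C.power e)) := by
  have : IsNoetherian (C.power e).left := by
    have := LocallyOfFiniteType.isLocallyNoetherian (C.power e).hom
    have := QuasiCompact.compactSpace_of_compactSpace (C.power e).hom
    exact {}
  exact Topology.IsInducing.noetherianSpace (i := RatPoint.pt) ⟨rfl⟩

/-- The rational point of `C^e` with the given coordinates. -/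
noncomputable def powerPoint (C : SmoothProjectiveCurve k) {e : ℕ} (x : Fin e → C.Point) :
    RatPoint (C.power e) :=
  Pi.lift (f := fun _ : Fin e => C.toOver) (P := Over.mk (𝟙 (Spec (.of k)))) x

theorem powerPoint_map (C : SmoothProjectiveCurve k) {e : ℕ} (x : Fin e → C.Point) (i : Fin e) :
    (C.powerPoint x).map (Pi.π (fun _ => C.toOver) i) = x i :=
  Pi.lift_π (P := Over.mk (𝟙 (Spec (.of k)))) _ _

/-- The divisor `x₁ + ⋯ + x_e` as a point of the symmetric product. -/
noncomputable def symPoint (C : SmoothProjectiveCurve k) {e : ℕ} (x : Fin e → C.Point) :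
    C.SymProd e :=
  C.toSymProd e (C.powerPoint x)

theorem continuous_toSymProd (C : SmoothProjectiveCurve k) (e : ℕ) :
    Continuous (C.toSymProd e) :=
  continuous_coinduced_rng

theorem symPoint_val (C : SmoothProjectiveCurve k) {e : ℕ} (x : Fin e → C.Point) :
    (C.symPoint x).1 = (Finset.univ : Finset (Fin e)).val.map x := by
  simp only [symPoint, toSymProd, powerPoint_map]

theorem exists_symPoint_eq (C : SmoothProjectiveCurve k) {e : ℕ} (D : C.SymProd e) :
    ∃ x : Fin e → C.Point, C.symPoint x = D := by
  obtain ⟨s, hs⟩ := D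
  obtain ⟨l, rfl⟩ := Quot.exists_rep s
  have hl : l.length = e := hs
  subst hl
  refine ⟨l.get, Subtype.ext ?_⟩
  rw [symPoint_val, Fin.univ_val_map, List.ofFn_get]
  rfl

theorem toDivisor_symPoint (C : SmoothProjectiveCurve k) {e : ℕ} (x : Fin e → C.Point) :
    (C.symPoint x).toDivisor = ∑ i, Finsupp.single (x i) (1 : ℤ) := by
  rw [SymProd.toDivisor, symPoint_val, Multiset.map_map]
  rfl

instance (C : SmoothProjectiveCurve k) (e : ℕ) :
    TopologicalSpace.NoetherianSpace (C.SymProd e) :=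
  TopologicalSpace.noetherianSpace_of_surjective _ (C.continuous_toSymProd e) fun D =>
    (C.exists_symPoint_eq D).imp' _ fun _ h => h

theorem continuous_symPoint_update (C : SmoothProjectiveCurve k) {e : ℕ} (x : Fin e → C.Point)
    (i : Fin e) : Continuous fun P : C.Point => C.symPoint (Function.update x i P) := by
  -- The map lifts to a morphism `C → C^e`: the identity in coordinate `i`, the constant `x j` in
  -- every other.
  let g : C.toOver ⟶ C.power e :=
    Pi.lift (Function.update (fun j => Over.mkIdTerminal.from C.toOver ≫ x j) i (𝟙 _))
  have hg : ∀ P : C.Point, P.map g = C.powerPoint (Function.update x i P) := by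
    intro P
    refine Pi.hom_ext (X := Over.mk (𝟙 (Spec (.of k)))) _ _ fun j => ?_
    refine Eq.trans ?_ (C.powerPoint_map _ j).symm
    refine (RatPoint.map_map P g _).trans ?_
    rw [Pi.lift_π]
    rcases eq_or_ne j i with rfl | hj
    · rw [Function.update_self, Function.update_self, RatPoint.map_id]
    · rw [Function.update_of_ne hj, Function.update_of_ne hj]
      change CategoryStruct.comp (X := Over.mk (𝟙 (Spec (.of k)))) P _ = x j
      refine (Category.assoc (W := Over.mk (𝟙 (Spec (.of k)))) P _ (x j)).symm.trans ?_
      rw [Over.mkIdTerminal.hom_ext (CategoryStruct.comp (X := Over.mk (𝟙 (Spec (.of k)))) P _)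
        (𝟙 _)]
      exact Category.id_comp (X := Over.mk (𝟙 (Spec (.of k)))) (x j)
  simp only [symPoint, ← hg]
  exact (C.continuous_toSymProd e).comp (RatPoint.continuous_map g)

theorem toDivisor_symPoint_update (C : SmoothProjectiveCurve k) {e : ℕ} (x : Fin e → C.Point)
    (i : Fin e) (P : C.Point) : (C.symPoint (Function.update x i P)).toDivisor =
      ∑ j ∈ Finset.univ.erase i, Finsupp.single (x j) (1 : ℤ) + Finsupp.single P 1 := by
  rw [toDivisor_symPoint, ← Finset.sum_erase_add _ _ (Finset.mem_univ i), Function.update_self]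
  congr 1
  exact Finset.sum_congr rfl fun j hj => by
    rw [Function.update_of_ne (Finset.ne_of_mem_erase hj)]

end SmoothProjectiveCurve

/-! ### Orders of vanishing and valuations -/

namespace SecantVarieties

/-- The multiplicative valuation is `exp (-ord)`, whence the inverse. -/
theorem le_ord_iff_valuation {X : Scheme.{u}} [IsIntegral X] [IsLocallyNoetherian X] {x : X}
    [IsDiscreteValuationRing (X.presheaf.stalk x)] (hx : Order.coheight x = 1)
    {φ : X.functionField} (hφ : φ ≠ 0) {n : ℤ} :
    n ≤ Scheme.ord φ x ↔ WithZero.exp n ≤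
      ((IsDiscreteValuationRing.maximalIdeal (X.presheaf.stalk x)).valuation
        X.functionField φ)⁻¹ := by
  rw [Scheme.le_ord_iff hx hφ, ← Ring.ordFrac_eq_valuation_inv]
  rfl

theorem exists_lift_of_ord_nonneg {X : Scheme.{u}} [IsIntegral X] [IsLocallyNoetherian X] {x : X}
    [IsDiscreteValuationRing (X.presheaf.stalk x)] (hx : Order.coheight x = 1)
    {φ : X.functionField} (hφ : φ ≠ 0) (h : 0 ≤ Scheme.ord φ x) :
    ∃ a : X.presheaf.stalk x, algebraMap _ X.functionField a = φ := by
  rw [le_ord_iff_valuation hx hφ, WithZero.exp_zero,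
    one_le_inv₀ (by simpa [zero_lt_iff] using hφ)] at h
  exact IsDiscreteValuationRing.exists_lift_of_le_one h

theorem one_le_ord_of_mem_maximalIdeal {X : Scheme.{u}} [IsIntegral X] [IsLocallyNoetherian X]
    {x : X} [IsDiscreteValuationRing (X.presheaf.stalk x)] (hx : Order.coheight x = 1)
    {a : X.presheaf.stalk x} (ha : a ∈ IsLocalRing.maximalIdeal (X.presheaf.stalk x))
    (ha0 : algebraMap _ X.functionField a ≠ 0) :
    1 ≤ Scheme.ord (algebraMap _ X.functionField a) x := by
  have hv := (IsDiscreteValuationRing.maximalIdeal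
    (X.presheaf.stalk x)).intValuation_le_pow_iff_mem a 1
  rw [le_ord_iff_valuation hx ha0, IsDedekindDomain.HeightOneSpectrum.valuation_of_algebraMap,
    ← inv_inv (WithZero.exp 1)]
  refine inv_anti₀ ?_ ?_
  · rw [zero_lt_iff, ← IsDedekindDomain.HeightOneSpectrum.valuation_of_algebraMap
      (K := X.functionField)]
    exact (Valuation.ne_zero_iff _).mpr ha0
  · rw [← WithZero.exp_neg]
    refine hv.mpr ?_
    rw [pow_one]
    exact ha

end SecantVarieties

/-! ### Rational functions at general and at given points of the curve -/

namespace SmoothProjectiveCurve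

variable {k : Type u} [Field k]

instance (C : SmoothProjectiveCurve k) : PreirreducibleSpace C.toOver.left :=
  inferInstanceAs (PreirreducibleSpace C.scheme)

theorem ordAt_inv (C : SmoothProjectiveCurve k) (P : C.Point)
    {φ : C.scheme.functionField} (hφ : φ ≠ 0) : C.ordAt P φ⁻¹ = - C.ordAt P φ := by
  have h : C.ordAt P (φ * φ⁻¹) = C.ordAt P φ + C.ordAt P φ⁻¹ :=
    Scheme.ord_mul hφ (inv_ne_zero hφ)
  rw [mul_inv_cancel₀ hφ, ← map_one C.constants, C.ordAt_constants P one_ne_zero] at h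
  linarith

variable [IsAlgClosed k]

instance (C : SmoothProjectiveCurve k) : PreirreducibleSpace C.Point :=
  RatPoint.preirreducibleSpace

theorem isDiscreteValuationRing_stalk_pt (C : SmoothProjectiveCurve k) (P : C.Point) :
    IsDiscreteValuationRing (C.scheme.presheaf.stalk P.pt) :=
  isDiscreteValuationRing_stalk C.str (RatPoint.isClosed_pt P)

theorem coheight_pt (C : SmoothProjectiveCurve k) (P : C.Point) :
    Order.coheight (P.pt : C.scheme) = 1 := by
  have := C.isDiscreteValuationRing_stalk_pt P
  have h := ringKrullDim_stalk_eq_coheight (X := C.scheme) P.pt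
  rw [IsDiscreteValuationRing.ringKrullDim_eq_one] at h
  exact_mod_cast h.symm

theorem pt_ne_genericPoint (C : SmoothProjectiveCurve k) (P : C.Point) :
    (P.pt : C.scheme) ≠ genericPoint C.scheme := by
  intro h
  have hmax : ¬ IsMax (P.pt : C.scheme) := by
    rw [← Order.coheight_eq_zero, C.coheight_pt P]
    exact one_ne_zero
  obtain ⟨y, hy⟩ := not_isMax_iff.mp hmax
  have hs : (P.pt : C.scheme) ⤳ y := h ▸ (genericPoint_spec C.scheme).specializes trivial
  exact hy.ne' (hs.mem_closed (RatPoint.isClosed_pt P) rfl)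

theorem exists_isOpen_divisor_eq_zero (C : SmoothProjectiveCurve k) (A : C.Divisor) :
    ∃ U : Set C.Point, IsOpen U ∧ U.Nonempty ∧ ∀ P ∈ U, A P = 0 := by
  let F : Set C.scheme := RatPoint.pt '' (A.support : Set C.Point)
  have hF : IsClosed F := by
    rw [← Set.biUnion_of_singleton F]
    refine (A.support.finite_toSet.image _).isClosed_biUnion ?_
    rintro _ ⟨P, -, rfl⟩
    exact RatPoint.isClosed_pt P
  have hne : (Fᶜ).Nonempty := by
    refine ⟨genericPoint C.scheme, ?_⟩
    rintro ⟨P, -, hP⟩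
    exact C.pt_ne_genericPoint P hP
  refine ⟨RatPoint.pt ⁻¹' Fᶜ, hF.isOpen_compl.preimage RatPoint.continuous_pt,
    RatPoint.exists_pt_mem (X := C.toOver) hF.isOpen_compl hne, fun P hP => ?_⟩
  by_contra h
  exact hP ⟨P, Finsupp.mem_support_iff.mpr h, rfl⟩

theorem exists_isOpen_ordAt_eq_zero (C : SmoothProjectiveCurve k) {φ : C.scheme.functionField}
    (hφ : φ ≠ 0) : ∃ U : Set C.Point, IsOpen U ∧ U.Nonempty ∧ ∀ P ∈ U, C.ordAt P φ = 0 := by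
  obtain ⟨V, hV, f, rfl⟩ := C.scheme.presheaf.exists_germ_eq φ
  -- The order vanishes wherever the section `f` representing `φ` is a unit, and `f` is a unit at
  -- the generic point.
  have hη : genericPoint C.scheme ∈ C.scheme.basicOpen f :=
    (C.scheme.mem_basicOpen f _ hV).mpr (IsUnit.mk0 _ hφ)
  have : Nonempty (C.scheme.basicOpen f) := ⟨⟨_, hη⟩⟩
  refine ⟨RatPoint.pt ⁻¹' (C.scheme.basicOpen f : Set C.scheme),
    (C.scheme.basicOpen f).isOpen.preimage RatPoint.continuous_pt,
    RatPoint.exists_pt_mem (X := C.toOver) (C.scheme.basicOpen f).isOpen ⟨_, hη⟩, fun P hP => ?_⟩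
  have h := Scheme.ord_of_isUnit (U := C.scheme.basicOpen f)
    (C.scheme.toLocallyRingedSpace.toRingedSpace.isUnit_res_basicOpen f)
    (x := P.pt) hP
  rw [ordAt, ← h]
  congr 1
  exact (C.scheme.presheaf.germ_res_apply _ _ hη f).symm

/-- The residue field at `P` is `k`, so `c` can be taken to be the value of `φ` at `P`. -/
theorem exists_constant_of_ordAt_nonneg (C : SmoothProjectiveCurve k) (P : C.Point)
    {φ : C.scheme.functionField} (hφ : φ ≠ 0) (h : 0 ≤ C.ordAt P φ) :
    ∃ c : k, φ - C.constants c = 0 ∨ 1 ≤ C.ordAt P (φ - C.constants c) := by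
  have := C.isDiscreteValuationRing_stalk_pt P
  obtain ⟨a, rfl⟩ := exists_lift_of_ord_nonneg (X := C.scheme) (C.coheight_pt P) hφ h
  have hr := isIso_toResidueField C.str (RatPoint.isClosed_pt P)
  obtain ⟨b, hb⟩ := (ConcreteCategory.bijective_of_isIso (C.str.appTop ≫
    C.scheme.presheaf.germ ⊤ (P.pt : C.scheme) trivial ≫ C.scheme.residue P.pt)).2
      (C.scheme.residue P.pt a)
  let b' := (C.str.appTop ≫ C.scheme.presheaf.germ ⊤ (P.pt : C.scheme) trivial) b
  refine ⟨(Scheme.ΓSpecIso (.of k)).hom b, or_iff_not_imp_left.mpr fun hne => ?_⟩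
  have hb' : C.constants ((Scheme.ΓSpecIso (.of k)).hom b) =
      algebraMap _ C.scheme.functionField b' := by
    have : Nonempty (⊤ : C.scheme.Opens) := ⟨⟨genericPoint C.scheme, trivial⟩⟩
    have h1 := C.scheme.algebraMap_germ_eq_germToFunctionField (U := ⊤) (x := P.pt) trivial
      (C.str.appTop b)
    refine Eq.trans ?_ h1.symm
    have h2 : (Scheme.ΓSpecIso (.of k)).inv ((Scheme.ΓSpecIso (.of k)).hom b) = b := by simp
    change (C.scheme.presheaf.germ ⊤ (genericPoint C.scheme) trivial) (C.str.appTop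
      ((Scheme.ΓSpecIso (.of k)).inv ((Scheme.ΓSpecIso (.of k)).hom b))) = _
    rw [h2]
  rw [hb', ← map_sub] at hne ⊢
  refine one_le_ord_of_mem_maximalIdeal (X := C.scheme) (C.coheight_pt P) ?_ hne
  rw [← IsLocalRing.residue_eq_zero_iff, map_sub, sub_eq_zero]
  exact hb.symm

end SmoothProjectiveCurve

/-! ### Conditions imposed by points on a linear series -/

theorem Submodule.finrank_inf_le_of_sub_smul_mem {k M : Type*} [Field k] [AddCommGroup M]
    [Module k M] (V S T : Submodule k M) [FiniteDimensional k V]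
    (h : ∀ φ ∈ S, ∀ ψ ∈ S, ψ ∉ T → ∃ c : k, φ - c • ψ ∈ T) :
    Module.finrank k ↥(V ⊓ S) ≤ Module.finrank k ↥(V ⊓ T) + 1 := by
  have : FiniteDimensional k ↥(V ⊓ S) := Submodule.finiteDimensional_inf_left V S
  have : FiniteDimensional k ↥(V ⊓ T) := Submodule.finiteDimensional_inf_left V T
  by_cases hV : V ⊓ S ≤ T
  · exact (Submodule.finrank_mono (le_inf inf_le_left hV)).trans (Nat.le_succ _)
  obtain ⟨ψ, hψ, hψT⟩ := Set.not_subset.mp hV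
  have hle : V ⊓ S ≤ (V ⊓ T) ⊔ k ∙ ψ := by
    intro φ hφ
    obtain ⟨c, hc⟩ := h φ hφ.2 ψ hψ.2 hψT
    rw [← sub_add_cancel φ (c • ψ)]
    exact Submodule.add_mem_sup ⟨V.sub_mem hφ.1 (V.smul_mem c hψ.1), hc⟩
      (Submodule.smul_mem _ _ (Submodule.mem_span_singleton_self ψ))
  calc _ ≤ Module.finrank k ↥((V ⊓ T) ⊔ k ∙ ψ) := Submodule.finrank_mono hle
    _ ≤ Module.finrank k ↥(V ⊓ T) + Module.finrank k ↥(k ∙ ψ) :=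
      Submodule.finrank_add_le_finrank_add_finrank _ _
    _ ≤ _ := Nat.add_le_add_left ((finrank_span_le_card {ψ}).trans (by simp)) _

namespace SmoothProjectiveCurve

variable {k : Type u} [Field k] [IsAlgClosed k]

theorem globalSections_mono (C : SmoothProjectiveCurve k) {A B : C.Divisor} (h : A ≤ B) :
    C.globalSections A ≤ C.globalSections B := by
  rintro φ (rfl | hφ)
  · exact zero_mem _
  · exact Or.inr fun P => (hφ P).trans (by linarith [h P])

theorem mem_globalSections_sub_single (C : SmoothProjectiveCurve k) {A : C.Divisor} {P : C.Point}
    {φ : C.scheme.functionField} (hφ0 : φ ≠ 0) (hφ : φ ∈ C.globalSections A) :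
    φ ∈ C.globalSections (A - Finsupp.single P 1) ↔ 1 ≤ C.ordAt P φ + A P := by
  classical
  refine ⟨fun h => ?_, fun h => Or.inr fun Q => ?_⟩
  · have := h.resolve_left hφ0 P
    rw [Finsupp.sub_apply, Finsupp.single_eq_same] at this
    linarith
  · rw [Finsupp.sub_apply, Finsupp.single_apply]
    split_ifs with hPQ
    · subst hPQ
      linarith
    · simpa using hφ.resolve_left hφ0 Q

/-- Since `ψ` has the least order at `P` allowed by `A`, the quotient `φ / ψ` is regular there; `c`
is its value at `P`. Thus one more point costs at most one dimension. -/
theorem exists_sub_smul_mem_globalSections (C : SmoothProjectiveCurve k) (A : C.Divisor)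
    (P : C.Point) {φ ψ : C.scheme.functionField} (hφ : φ ∈ C.globalSections A)
    (hψ : ψ ∈ C.globalSections A) (hψ' : ψ ∉ C.globalSections (A - Finsupp.single P 1)) :
    ∃ c : k, φ - c • ψ ∈ C.globalSections (A - Finsupp.single P 1) := by
  rcases eq_or_ne φ 0 with rfl | hφ0
  · exact ⟨0, by simp⟩
  have hψ0 : ψ ≠ 0 := by
    rintro rfl
    exact hψ' (zero_mem _)
  have h1 := hφ.resolve_left hφ0 P
  have h2 := hψ.resolve_left hψ0 P
  rw [C.mem_globalSections_sub_single hψ0 hψ, not_le] at hψ'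
  have hmul : ∀ {f g : C.scheme.functionField}, f ≠ 0 → g ≠ 0 →
      C.ordAt P (f * g) = C.ordAt P f + C.ordAt P g := fun hf hg => Scheme.ord_mul hf hg
  have hquot : 0 ≤ C.ordAt P (φ * ψ⁻¹) := by
    rw [hmul hφ0 (inv_ne_zero hψ0), C.ordAt_inv P hψ0]
    linarith
  obtain ⟨c, hc⟩ := C.exists_constant_of_ordAt_nonneg P
    (mul_ne_zero hφ0 (inv_ne_zero hψ0)) hquot
  have heq : φ - c • ψ = (φ * ψ⁻¹ - C.constants c) * ψ := by
    rw [sub_mul, inv_mul_cancel_right₀ hψ0]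
    rfl
  refine ⟨c, ?_⟩
  rcases eq_or_ne (φ - c • ψ) 0 with h0 | h0
  · rw [h0]
    exact zero_mem _
  rw [C.mem_globalSections_sub_single h0 (sub_mem hφ (Submodule.smul_mem _ c hψ)), heq]
  have hne : φ * ψ⁻¹ - C.constants c ≠ 0 := fun h => h0 (by rw [heq, h, zero_mul])
  rw [hmul hne hψ0]
  linarith [hc.resolve_left hne]

theorem LinearSeries.finiteDimensional_space {C : SmoothProjectiveCurve k} {r d : ℕ}
    (l : C.LinearSeries r d) : FiniteDimensional k l.space :=
  FiniteDimensional.of_finrank_pos (l.finrank_eq ▸ Nat.succ_pos r)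

/-- The dimension of `V ∩ H⁰(C, L(-D))`. -/
noncomputable def LinearSeries.rankSub {C : SmoothProjectiveCurve k} {r d : ℕ}
    (l : C.LinearSeries r d) (D : C.Divisor) : ℕ :=
  Module.finrank k ↥(l.space ⊓ C.globalSections (l.divisor - D))

theorem LinearSeries.rankSub_le_rankSub_add_single {C : SmoothProjectiveCurve k} {r d : ℕ}
    (l : C.LinearSeries r d) (D : C.Divisor) (P : C.Point) :
    l.rankSub D ≤ l.rankSub (D + Finsupp.single P 1) + 1 := by
  have := l.finiteDimensional_space
  rw [rankSub, rankSub, ← sub_sub]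
  exact Submodule.finrank_inf_le_of_sub_smul_mem _ _ _
    fun φ hφ ψ hψ hψ' => C.exists_sub_smul_mem_globalSections _ P hφ hψ hψ'

theorem LinearSeries.rankSub_anti {C : SmoothProjectiveCurve k} {r d : ℕ}
    (l : C.LinearSeries r d) {D E : C.Divisor} (h : D ≤ E) : l.rankSub E ≤ l.rankSub D := by
  have := l.finiteDimensional_space
  have := Submodule.finiteDimensional_inf_left l.space (C.globalSections (l.divisor - D))
  exact Submodule.finrank_mono (inf_le_inf_left _ (C.globalSections_mono (sub_le_sub_left h _)))

/-- A general point of the curve imposes a condition on a nonempty linear series. -/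
theorem LinearSeries.exists_isOpen_rankSub_add_single_le {C : SmoothProjectiveCurve k} {r d : ℕ}
    (l : C.LinearSeries r d) (D : C.Divisor) : ∃ U : Set C.Point, IsOpen U ∧ U.Nonempty ∧
      ∀ P ∈ U, l.rankSub (D + Finsupp.single P 1) ≤ l.rankSub D - 1 := by
  have := l.finiteDimensional_space
  obtain ⟨U, hU, hUne, hUA⟩ := C.exists_isOpen_divisor_eq_zero (l.divisor - D)
  by_cases hbot : l.space ⊓ C.globalSections (l.divisor - D) = ⊥
  -- For an empty series the truncated bound `0 - 1 = 0` is met by monotonicity alone.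
  · refine ⟨U, hU, hUne, fun P _ => ?_⟩
    refine (l.rankSub_anti
      (le_add_of_nonneg_right (Finsupp.single_nonneg.mpr zero_le_one))).trans ?_
    have h0 : l.rankSub D = 0 := by rw [rankSub, hbot, finrank_bot]
    rw [h0]
  obtain ⟨φ, hφ, hφ0⟩ := Submodule.exists_mem_ne_zero_of_ne_bot hbot
  -- Off the support of `l.divisor - D` and the zeros and poles of `φ`, the section `φ` does not
  -- vanish at `P`, so it is lost on passing to `D + P`.
  obtain ⟨V, hV, hVne, hVφ⟩ := C.exists_isOpen_ordAt_eq_zero hφ0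
  refine ⟨U ∩ V, hU.inter hV, nonempty_preirreducible_inter hU hV hUne hVne, fun P hP => ?_⟩
  have := Submodule.finiteDimensional_inf_left l.space (C.globalSections (l.divisor - D))
  refine Nat.le_sub_one_of_lt (Submodule.finrank_lt_finrank_of_lt ?_)
  rw [← sub_sub]
  refine lt_of_le_of_ne (inf_le_inf_left _ (C.globalSections_mono
    (sub_le_self _ (Finsupp.single_nonneg.mpr zero_le_one)))) fun h => ?_
  rw [← h] at hφ
  have h1 := (C.mem_globalSections_sub_single hφ0 (C.globalSections_mono
    (sub_le_self _ (Finsupp.single_nonneg.mpr zero_le_one)) hφ.2)).mp hφ.2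
  rw [hUA P hP.1, hVφ P hP.2] at h1
  exact absurd h1 (by norm_num)

theorem LinearSeries.mem_secantVariety_iff {C : SmoothProjectiveCurve k} {r d : ℕ}
    (l : C.LinearSeries r d) {e : ℕ} {c : ℤ} {D : C.SymProd e} :
    D ∈ l.secantVariety e c ↔ (r : ℤ) + 1 - c ≤ l.rankSub D.toDivisor := by
  change (r : ℤ) - c ≤ (l.rankSub D.toDivisor : ℤ) - 1 ↔ _
  constructor <;> intro h <;> linarith

/-- Replacing one point of a divisor changes the number of conditions by at most one. -/
theorem LinearSeries.symPoint_update_mem_secantVariety {C : SmoothProjectiveCurve k} {r d : ℕ}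
    (l : C.LinearSeries r d) {e : ℕ} {c : ℤ} {x : Fin e → C.Point}
    (hx : C.symPoint x ∈ l.secantVariety e (c - 1)) (i : Fin e) (P : C.Point) :
    C.symPoint (Function.update x i P) ∈ l.secantVariety e c := by
  rw [← Function.update_eq_self i x] at hx
  rw [mem_secantVariety_iff, toDivisor_symPoint_update] at hx ⊢
  -- Dropping `x i` cannot lower the rank (`h2`), and adding `P` lowers it by at most one (`h1`).
  have h1 := l.rankSub_le_rankSub_add_single
    (∑ j ∈ Finset.univ.erase i, Finsupp.single (x j) (1 : ℤ)) P
  have h2 := l.rankSub_anti (le_add_of_nonneg_right (a := ∑ j ∈ Finset.univ.erase i,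
    Finsupp.single (x j) (1 : ℤ))
    (Finsupp.single_nonneg.mpr zero_le_one : 0 ≤ Finsupp.single (x i) (1 : ℤ)))
  omega

/-- The points are replaced one at a time; after `n` steps the first `n` are general and impose
`min(n, r+1)` conditions, hence the truncated `r + 1 - n`. Hypothesis `hOc` restores the slack in
`c` before each step. -/
theorem LinearSeries.exists_rankSub_le {C : SmoothProjectiveCurve k} {r d : ℕ}
    (l : C.LinearSeries r d) {e : ℕ} {c : ℤ} {O : Set (C.SymProd e)} (hO : IsOpen O)
    (hOc : ∀ D ∈ O, D ∈ l.secantVariety e c → D ∈ l.secantVariety e (c - 1))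
    {D₀ : C.SymProd e} (hD₀ : D₀ ∈ O) (hD₀' : D₀ ∈ l.secantVariety e c) (n : ℕ) (hn : n ≤ e) :
    ∃ x : Fin e → C.Point, C.symPoint x ∈ O ∧ C.symPoint x ∈ l.secantVariety e c ∧
      l.rankSub (∑ i with i.val < n, Finsupp.single (x i) 1) ≤ r + 1 - n := by
  classical
  induction n with
  | zero =>
    obtain ⟨x, rfl⟩ := C.exists_symPoint_eq D₀
    refine ⟨x, hD₀, hD₀', ?_⟩
    have := l.finiteDimensional_space
    exact (Submodule.finrank_mono inf_le_left).trans l.finrank_eq.le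
  | succ n ih =>
    obtain ⟨x, hxO, hxc, hx⟩ := ih (Nat.le_of_succ_le hn)
    obtain ⟨U, hU, hUne, hUr⟩ := l.exists_isOpen_rankSub_add_single_le
      (∑ i with i.val < n, Finsupp.single (x i) 1)
    let i : Fin e := ⟨n, hn⟩
    -- The open set of `P` keeping the divisor in `O` is nonempty because it contains the old point
    -- `x i`; as `C` is irreducible, it meets the general set `U`.
    obtain ⟨P, hPU, hPO⟩ := nonempty_preirreducible_inter hU
      (hO.preimage (C.continuous_symPoint_update x i)) hUne
      ⟨x i, by rwa [Set.mem_preimage, Function.update_eq_self]⟩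
    refine ⟨Function.update x i P, hPO,
      l.symPoint_update_mem_secantVariety (hOc _ hxO hxc) i P, ?_⟩
    have hfilter : (Finset.univ.filter fun j : Fin e => j.val < n + 1) =
        insert i (Finset.univ.filter fun j : Fin e => j.val < n) := by
      ext j
      simp only [Finset.mem_filter, Finset.mem_univ, true_and, Finset.mem_insert, Fin.ext_iff, i]
      omega
    have hsum : ∑ j with j.val < n + 1, Finsupp.single (Function.update x i P j) (1 : ℤ) =
        ∑ j with j.val < n, Finsupp.single (x j) 1 + Finsupp.single P 1 := by
      rw [hfilter, Finset.sum_insert (by simp [i]), Function.update_self, add_comm]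
      congr 1
      refine Finset.sum_congr rfl fun j hj => ?_
      rw [Function.update_of_ne]
      rintro rfl
      simp [i] at hj
    rw [hsum]
    have := hUr P hPU
    omega

end SmoothProjectiveCurve

theorem mainTheorem5 {k : Type u} [Field k] [IsAlgClosed k] (C : SmoothProjectiveCurve k)
    {r d : ℕ} (l : C.LinearSeries r d) (hl : l.IsComplete)
    (e f : ℕ) (hfe : f < e) (hed : e < d) (hef : e ≤ r + 1 + f) :
    ∀ Z ∈ irreducibleComponents ↥(l.secantVariety e ((e : ℤ) - f)),
      ¬ (Subtype.val '' Z ⊆ l.secantVariety e ((e : ℤ) - f - 1)) := by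
  intro Z hZ hsub
  have : TopologicalSpace.NoetherianSpace ↥(l.secantVariety e ((e : ℤ) - f)) :=
    Topology.IsInducing.subtypeVal.noetherianSpace
  obtain ⟨o, ho, ⟨D₀, hD₀⟩, hoZ⟩ :=
    TopologicalSpace.NoetherianSpace.exists_isOpen_nonempty_subset_irreducibleComponent Z hZ
  obtain ⟨O, hO, rfl⟩ := isOpen_induced_iff.mp ho
  obtain ⟨x, hxO, hxc, hx⟩ := l.exists_rankSub_le hO
    (fun D hD hDc => hsub ⟨⟨D, hDc⟩, hoZ hD, rfl⟩) hD₀ D₀.2 e le_rfl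
  have h := hsub ⟨⟨_, hxc⟩, hoZ hxO, rfl⟩
  rw [SmoothProjectiveCurve.LinearSeries.mem_secantVariety_iff,
    SmoothProjectiveCurve.toDivisor_symPoint] at h
  simp only [Fin.is_lt, Finset.filter_true] at hx
  -- Here `h` gives rank at least `r + 2 + f - e`, which is positive by `hef` and larger than `r + 1
  -- - e`, while `hx` bounds the rank by the truncated `r + 1 - e`.
  omega
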